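/- Let $G$ be a countable group, let $k\ge 1$ be an integer, and let $G$ act on $k^G=\{1,\dots,k\}^G$ (product topology) by $(gx)_h=x_{g^{-1}h}$. Let $H_1\supseteq H_2\supseteq\cdots$ be normal subgroups of finite index in $G$ with $\bigcap_n H_n=\{e\}$. For $H\le G$ let $\mathrm{Per}_H(x)=\{g\in G: x_{h^{-1}g}=x_g \text{ for all } h\in H\}$, let $\#\mathrm{Per}_H(x,*)$ be the number of cosets of $H$ disjoint from $\mathrm{Per}_H(x)$ (the cosets on which the $H$-skeleton of $x$ is a hole), and for $v\in G/H$ let $x(v)\subseteq\{1,\dots,k\}$ be the set of symbols that $x$ takes on the coset $v$. Let $x\in k^G$ be Toeplitz with respect to $(H_n)$, that is, $G=\bigcup_n \mathrm{Per}_{H_n}(x)$, and let $X=\overline{Gx}$. A sofic approximation of $G$ is a sequence $\Sigma=\{\sigma_n\colon G\to\mathrm{Sym}(V_n)\}$ of maps, with $V_n$ finite, such that $|\{v\in V_n:\sigma_{n}(st)v=\sigma_{n}(s)\sigma_{n}(t)v\}|/|V_n|\to1$ for all $s,t\in G$ and $|\{v\in V_n:\sigma_{n}(s)v\ne\sigma_{n}(t)v\}|/|V_n|\to1$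 for all $s\ne t$. The sofic topological entropy $h_\Sigma(X,G)\in[-\infty,\infty]$ is the common value, over all continuous pseudometrics $d$ on $X$ that are dynamically generating (for all $y\neq z$ in $X$ there is $s\in G$ with $d(sy,sz)>0$), of $$h_\Sigma(d)=\sup_{\varepsilon>0}\ \inf_{F\subset G\text{ finite}}\ \inf_{\delta>0}\ \limsup_{n\to\infty}\frac1{|V_n|}\log N_\varepsilon\big(\mathrm{Map}(d,F,\delta,\sigma_n),d_\infty\big),\qquad \log 0=-\infty,$$ where $\mathrm{Map}(d,F,\delta,\sigma)$ is the set of maps $\varphi\colon V\to X$ with $\big(\frac1{|V|}\sum_{v\in V}d(\varphi(\sigma(s)v),s\varphi(v))^2\big)^{1/2}\le\delta$ for all $s\in F$, $d_\infty(\varphi,\psi)=\max_{v}d(\varphi(v),\psi(v))$, and $N_\varepsilon$ is the maximal cardinality of a subset whose distinct points are at $d_\infty$-distance $>\varepsilon$. Then the limit $\lim_{n\to\infty}\#\mathrm{Per}_{H_n}(x,*)/[G:H_n]$ exists, and $$h_\Sigma(X,G)\ \le\ \liminf_{n\to\infty}\frac1{[G:H_n]}\sum_{v\in G/H_n}\log|x(v)|\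 \le\ \lim_{n\to\infty}\frac{\#\mathrm{Per}_{H_n}(x,*)}{[G:H_n]}\log k$$ holds in each of the following two cases: 1. $G$ is infinite and $\Sigma=\{\sigma_n\}$ is any sofic approximation of $G$ by group homomorphisms with $\ker\sigma_n\subseteq H_n$ for every $n$. 2. $G$ is a free group freely generated by a finite set $S$, and $\Sigma=\{\sigma_n\}$ is any sofic approximation of $G$ (by maps that need not be homomorphisms) with $\mathrm{stab}\,\sigma_n\subseteq H_n$ for every $n$, where $\mathrm{stab}\,\sigma_n$ is the set of all $g\in G$ such that, writing $g=s_1^{\alpha_1}\cdots s_m^{\alpha_m}$ as a reduced word in $S$, the permutation $\sigma_n(s_1)^{\alpha_1}\circ\cdots\circ\sigma_n(s_m)^{\alpha_m}$ fixes every $v\in V_n$. -/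

import Mathlib

open Filter Topology
open scoped ENNReal

noncomputable section

/-! ### The full shift and orbit closures -/

/-- The full `G`-shift with base `k`, with the product topology. -/
def FullShift (G : Type*) (k : ℕ) : Type _ := G → Fin k

namespace FullShift

variable {G : Type*} {k : ℕ}

instance : TopologicalSpace (FullShift G k) :=
  inferInstanceAs (TopologicalSpace (G → Fin k))

/-- The shift action `(g x)_h = x_{g⁻¹ h}`. -/
instance [Group G] : MulAction G (FullShift G k) where
  smul g x := fun h => x (g⁻¹ * h)
  one_smul x := by
    funext h
    change x (1⁻¹ * h) = x h
    simp
  mul_smul a b x := by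
    funext h
    change x ((a * b)⁻¹ * h) = x (b⁻¹ * (a⁻¹ * h))
    simp [mul_assoc]

theorem smul_apply [Group G] (g : G) (x : FullShift G k) (h : G) :
    (g • x) h = x (g⁻¹ * h) := rfl

instance [Group G] : ContinuousConstSMul G (FullShift G k) where
  continuous_const_smul g :=
    continuous_pi fun h => continuous_apply (A := fun _ : G => Fin k) (g⁻¹ * h)

end FullShift

/-- The closure of the orbit of a point, as a subsystem. -/
def orbitClosure {G X : Type*} [Group G] [TopologicalSpace X] [MulAction G X]
    [ContinuousConstSMul G X] (x : X) : SubMulAction G X where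
  carrier := closure (MulAction.orbit G x)
  smul_mem' g y hy := by
    refine map_mem_closure (continuous_const_smul g) hy ?_
    intro z hz
    exact MulAction.mem_orbit_of_mem_orbit g hz

/-! ### Sofic approximations -/

/-- A sequence of maps `σ n : G → Sym (V n)` into the symmetric groups of finite sets is a sofic
approximation if it is asymptotically multiplicative and asymptotically free. -/
structure IsSoficApproximation {G : Type*} [Group G] (V : ℕ → Type*) [∀ n, Fintype (V n)]
    (σ : ∀ n, G → Equiv.Perm (V n)) : Prop where
  multiplicative : ∀ s t : G,
    Tendsto (fun n => ({v : V n | σ n (s * t) v = σ n s (σ n t v)}.ncard : ℝ)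
      / (Fintype.card (V n) : ℝ)) atTop (𝓝 1)
  free : ∀ s t : G, s ≠ t →
    Tendsto (fun n => ({v : V n | σ n t v ≠ σ n s v}.ncard : ℝ)
      / (Fintype.card (V n) : ℝ)) atTop (𝓝 1)

/-! ### Sofic topological entropy -/

/-- A continuous pseudometric on a topological space. -/
structure IsContinuousPseudometric {X : Type*} [TopologicalSpace X] (d : X → X → ℝ) : Prop where
  self : ∀ x, d x x = 0
  symm : ∀ x y, d x y = d y x
  triangle : ∀ x y z, d x z ≤ d x y + d y z
  continuous : Continuous fun p : X × X => d p.1 p.2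

/-- A pseudometric is dynamically generating if it separates any two distinct points somewhere
along their orbits. -/
def IsDynamicallyGenerating (G : Type*) {X : Type*} [SMul G X] (d : X → X → ℝ) : Prop :=
  ∀ x y : X, x ≠ y → ∃ s : G, 0 < d (s • x) (s • y)

/-- The normalized `ℓ²` pseudometric on maps `V → X`. -/
def dTwo {V X : Type*} [Fintype V] (d : X → X → ℝ) (φ ψ : V → X) : ℝ :=
  Real.sqrt ((1 / (Fintype.card V : ℝ)) * ∑ v, d (φ v) (ψ v) ^ 2)

/-- The maximum pseudometric on maps `V → X`. -/
def dInfty {V X : Type*} (d : X → X → ℝ) (φ ψ : V → X) : ℝ :=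
  ⨆ v, d (φ v) (ψ v)

/-- `Map(d, F, δ, τ)`: the approximately equivariant maps `V → X`. -/
def soficMap {G V X : Type*} [Fintype V] [SMul G X] (d : X → X → ℝ) (F : Finset G) (δ : ℝ)
    (τ : G → Equiv.Perm V) : Set (V → X) :=
  {φ | ∀ s ∈ F, dTwo d (fun v => φ (τ s v)) (fun v => s • φ v) ≤ δ}

/-- The maximal cardinality of a `(ρ, ε)`-separated subset of `Y`. -/
def sepNumber {Z : Type*} (ρ : Z → Z → ℝ) (ε : ℝ) (Y : Set Z) : ℕ∞ :=
  ⨆ (E : Finset Z) (_ : (E : Set Z) ⊆ Y) (_ : ∀ y ∈ E, ∀ z ∈ E, y ≠ z → ε < ρ y z),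
    (E.card : ℕ∞)

/-- The quantity `h_Σ(d)`. The logarithm takes values in `[-∞, ∞]` with `log 0 = -∞`, so that
the value is `-∞` when the sets `Map(d, F, δ, σ n)` are eventually empty for some `F`, `δ`. -/
def soficEntropyOfPseudometric {G X : Type*} [SMul G X] (V : ℕ → Type*) [∀ n, Fintype (V n)]
    (σ : ∀ n, G → Equiv.Perm (V n)) (d : X → X → ℝ) : EReal :=
  ⨆ (ε : ℝ) (_ : 0 < ε), ⨅ (F : Finset G), ⨅ (δ : ℝ) (_ : 0 < δ),
    limsup (fun n =>
      ENNReal.log ((sepNumber (dInfty d) ε (soficMap d F δ (σ n)) : ℕ∞) : ℝ≥0∞)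
        / ((Fintype.card (V n) : ℝ) : EReal)) atTop

/-- The sofic topological entropy `h_Σ(X, G)`: the common value of `h_Σ(d)` over all dynamically
generating continuous pseudometrics `d` on `X`, written as the supremum of these values. -/
def soficEntropy (G X : Type*) [TopologicalSpace X] [SMul G X] (V : ℕ → Type*)
    [∀ n, Fintype (V n)] (σ : ∀ n, G → Equiv.Perm (V n)) : EReal :=
  ⨆ (d : X → X → ℝ) (_ : IsContinuousPseudometric d) (_ : IsDynamicallyGenerating G d),
    soficEntropyOfPseudometric V σ d

/-! ### Toeplitz elements -/

section Toeplitz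

variable {G A : Type*} [Group G]

/-- The `H`-periodic part `Per_H(y)`. -/
def perPart (H : Subgroup G) (y : G → A) : Set G :=
  {g | ∀ h ∈ H, y (h⁻¹ * g) = y g}

/-- `Per_H(y, a)`. -/
def perPartAt (H : Subgroup G) (y : G → A) (a : A) : Set G :=
  {g | g ∈ perPart H y ∧ y g = a}

/-- `#Per_H(y, a)`: the number of cosets of `H` contained in `Per_H(y, a)`. -/
def numPer (H : Subgroup G) (y : G → A) (a : A) : ℕ :=
  {v : G ⧸ H | ∀ g : G, (g : G ⧸ H) = v → g ∈ perPartAt H y a}.ncard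

open Classical in
/-- The `H`-skeleton of `x`; the symbol `*` is `none`. -/
def skeleton (H : Subgroup G) (x : G → A) : G → Option A :=
  fun g => if g ∈ perPart H x then some (x g) else none

/-- `#Per_H(x, *)`: the number of `H`-holes of `x`. -/
def numHoles (H : Subgroup G) (x : G → A) : ℕ :=
  numPer H (skeleton H x) none

/-- `x` is a Toeplitz element with respect to the sequence `H`. -/
def IsToeplitz (H : ℕ → Subgroup G) (x : G → A) : Prop :=
  ⋃ n, perPart (H n) x = Set.univ

/-- `|x(v)|`: the number of symbols that `x` takes on the coset `v`. -/
def cosetSymbols (H : Subgroup G) (x : G → A) (v : G ⧸ H) : ℕ :=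
  (x '' {g : G | (g : G ⧸ H) = v}).ncard

/-- `(1 / [G : H]) ∑_{v ∈ G/H} log |x(v)|`, for `H` of finite index. -/
def cosetEntropy (H : Subgroup G) (x : G → A) : ℝ :=
  (1 / (H.index : ℝ)) * ∑ᶠ v : G ⧸ H, Real.log (cosetSymbols H x v)

end Toeplitz

/-! ### Stabilizers of maps on free groups -/

section Stab

variable {G S V : Type*} [Group G]

/-- `τ(s₁)^{α₁} ∘ … ∘ τ(s_m)^{α_m}` for the word `s₁^{α₁} ⋯ s_m^{α_m}` with `α_i = ±1`. -/
def evalWord (b : FreeGroupBasis S G) (τ : G → Equiv.Perm V) (w : List (S × Bool)) :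
    Equiv.Perm V :=
  (w.map fun p => cond p.2 (τ (b p.1)) (τ (b p.1))⁻¹).prod

open Classical in
/-- `stab τ`: the elements of the free group whose reduced word acts trivially on all of `V`. -/
def freeStab (b : FreeGroupBasis S G) (τ : G → Equiv.Perm V) : Set G :=
  {g | ∀ v : V, evalWord b τ (b.repr g).toWord v = v}

open Classical in
theorem evalWord_toWord (b : FreeGroupBasis S G) (τ : G → Equiv.Perm V) (g : G) :
    evalWord b τ (b.repr g).toWord = FreeGroup.lift (fun s => τ (b s)) (b.repr g) := by
  conv_rhs => rw [← FreeGroup.mk_toWord (x := b.repr g)]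
  rw [FreeGroup.lift_mk]
  rfl

end Stab

end

/-!
# Sofic entropy of orbit closures of Toeplitz elements

The entropy is bounded by the coset entropy of each `H = H m` separately, which gives the lower
limit. For an infinite group the bound holds for every sofic approximation, and a free group is
either infinite or trivial; in the trivial case `X` is a point.

*Symbol profiles.* To `z ∈ X` assign the function `profile H F z` on `G ⧸ H` giving the set of
symbols that `z` takes on each coset within a finite window `F`. Since `x` is Toeplitz, the finite
pattern of `x` witnessing all symbols on all cosets of `H` recurs with bounded gaps, so `F` can be
chosen to show all symbols on every coset for every translate of `x`
(`exists_isCompleteWindow`). As the orbit of `x` is dense in `X` and the profile depends on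
finitely many coordinates, the profile is a continuous equivariant map from `X` to a finite
`G`-set, the profile of every `z ∈ X` is a translate of that of `x`, and `z 1` belongs to the
profile of `z` at the trivial coset.

*Counting.* Let `φ : V → X` be approximately equivariant. For a separated set of such `φ`, the map
`φ` is determined by the symbols `φ v 1` together with a sparse set of exceptional data
(`exists_window_dist_lt`, `IsSoficApproximation.exists_card_not_rel_le`). The profile map
`c = profile ∘ φ` is approximately equivariant. It is determined by its values on a maximal family
of points with pairwise disjoint sets `σ P w`, where `P` is a large finite subset of `G`, and on
the exceptional points; both sets are sparse, so the number of possible `c` has a small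
exponential growth rate (`card_le_of_approximately_equivariant`). This is where `G` is infinite.
Given `c`, the symbol `φ v 1` lies in `c v` evaluated at the trivial coset. Averaging over coset
representatives `t` and using that each `σ t` is a bijection, the logarithm of the number of
choices is at most about `|V|` times the coset entropy of `H`
(`IsCompleteWindow.prod_card_profile_le`).

*Holes.* The density of holes is nonincreasing in `n`, hence converges. A coset that is not a hole
carries a single symbol, and a hole carries at most `k`, which bounds the coset entropy by
the density of holes times `log k` (`cosetEntropy_le`).
-/

/-! ### Counting -/

/-- The number of partially defined functions on `V` whose domain has size at most `β |V|` grows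
with a small exponential rate when `β` is small. -/
theorem exists_card_sparse_le (D : Type*) [Fintype D] {η : ℝ} (hη : 0 < η) :
    ∃ β : ℝ, 0 < β ∧ ∀ (V : Type*) [Fintype V] (s : Finset (V → Option D)),
      (∀ g ∈ s, ((Finset.univ.filter fun v => g v ≠ none).card : ℝ) ≤ β * Fintype.card V) →
      (s.card : ℝ) ≤ Real.exp (η * Fintype.card V) := by
  classical
  set l : ℝ := 2 * Fintype.card D / η + 1 with hl
  have hl0 : 0 < l := by positivity
  refine ⟨η / (2 * l), by positivity, fun V _ s hs => ?_⟩
  -- Each partial function gets the weight `exp (-l)` to the power of the size of its domain.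
  let w : Option D → ℝ := fun o => if o = none then 1 else Real.exp (-l)
  have hprod : ∀ g : V → Option D,
      ∏ v, w (g v) = Real.exp (-l * (Finset.univ.filter fun v => g v ≠ none).card) := by
    intro g
    simp only [w]
    rw [Finset.prod_ite, Finset.prod_const_one, one_mul, Finset.prod_const, ← Real.exp_nat_mul,
      mul_comm]
  have hsum : ∑ o, w o = 1 + Fintype.card D * Real.exp (-l) := by
    simp [w, Fintype.sum_option]
  have htot : ∑ g : V → Option D, ∏ v, w (g v)
      = (1 + Fintype.card D * Real.exp (-l)) ^ Fintype.card V := by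
    rw [← hsum, ← Finset.card_univ (α := V), ← Finset.prod_const, Finset.prod_univ_sum,
      Fintype.piFinset_univ]
  have hexp : Fintype.card D * Real.exp (-l) ≤ η / 2 := by
    have h1 : l ≤ Real.exp l := by linarith [Real.add_one_le_exp l]
    rw [Real.exp_neg, ← div_eq_mul_inv, div_le_iff₀ (Real.exp_pos l)]
    have h2 : (Fintype.card D : ℝ) ≤ η / 2 * l := by
      rw [hl]; field_simp; linarith
    exact h2.trans (mul_le_mul_of_nonneg_left h1 (by positivity))
  have hlow : (s.card : ℝ) * Real.exp (-(η / 2 * Fintype.card V))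
      ≤ ∑ g : V → Option D, ∏ v, w (g v) := by
    rw [← nsmul_eq_mul]
    refine (Finset.card_nsmul_le_sum s _ _ fun g hg => ?_).trans
      (Finset.sum_le_sum_of_subset_of_nonneg (Finset.subset_univ s) fun g _ _ => ?_)
    · rw [hprod]
      apply Real.exp_le_exp.2
      have := mul_le_mul_of_nonneg_left (hs g hg) hl0.le
      have h3 : l * (η / (2 * l) * Fintype.card V) = η / 2 * Fintype.card V := by field_simp
      linarith
    · rw [hprod]; positivity
  have hup : (1 + Fintype.card D * Real.exp (-l)) ^ Fintype.card V
      ≤ Real.exp (η / 2 * Fintype.card V) := by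
    rw [mul_comm (η / 2), Real.exp_nat_mul]
    refine pow_le_pow_left₀ (by positivity) ?_ _
    linarith [Real.add_one_le_exp (η / 2)]
  rw [htot] at hlow
  have := mul_le_mul_of_nonneg_right (hlow.trans hup) (Real.exp_pos (η / 2 * Fintype.card V)).le
  rw [mul_assoc, ← Real.exp_add, ← Real.exp_add] at this
  simp only [neg_add_cancel, Real.exp_zero, mul_one] at this
  rwa [← add_mul, add_halves] at this

/-- A maximal family of points of `P` with pairwise disjoint sets `τ F w`: it has at most
`|V| / |F|` members, and `τ F v` meets one of these sets for every `v ∈ P`. -/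
theorem exists_packing {G V : Type*} [Fintype V] (τ : G → V → V) (F : Finset G) (hF : F.Nonempty)
    (P : Finset V) (hP : ∀ v ∈ P, Set.InjOn (fun s => τ s v) F) :
    ∃ W ⊆ P, W.card * F.card ≤ Fintype.card V ∧
      ∀ v ∈ P, ∃ w ∈ W, ∃ s ∈ F, ∃ t ∈ F, τ s v = τ t w := by
  classical
  let I : V → Finset V := fun v => F.image fun s => τ s v
  obtain ⟨W, hW⟩ := (P.powerset.filter fun W : Finset V =>
    (W : Set V).PairwiseDisjoint I).exists_maximal ⟨∅, by simp⟩
  have hWm := hW.prop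
  rw [Finset.mem_filter, Finset.mem_powerset] at hWm
  refine ⟨W, hWm.1, ?_, fun v hv => ?_⟩
  · have h1 : (W.biUnion I).card = W.card * F.card := by
      rw [Finset.card_biUnion hWm.2]
      refine Finset.sum_const_nat fun w hw => Finset.card_image_of_injOn (hP w (hWm.1 hw))
    rw [← h1]
    exact Finset.card_le_univ _
  · by_contra hcon
    push Not at hcon
    obtain ⟨s₀, hs₀⟩ := hF
    have hvW : v ∉ W := fun h => hcon v h s₀ hs₀ s₀ hs₀ rfl
    have hins : insert v W ∈ P.powerset.filter fun W : Finset V =>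
        (W : Set V).PairwiseDisjoint I := by
      rw [Finset.mem_filter, Finset.mem_powerset]
      refine ⟨Finset.insert_subset hv hWm.1, ?_⟩
      rw [Finset.coe_insert]
      refine hWm.2.insert fun w hw _ => ?_
      rw [Finset.disjoint_left]
      intro u hu hu'
      obtain ⟨s, hs, rfl⟩ := Finset.mem_image.1 hu
      obtain ⟨t, ht, hst⟩ := Finset.mem_image.1 hu'
      exact hcon w hw s hs t ht hst.symm
    exact hvW (hW.le_of_ge hins (Finset.subset_insert v W) (Finset.mem_insert_self v W))

/-- A bound for a finite set `E` of objects `φ`, each with an approximately equivariant map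
`c φ : V → C` and a map `ψ φ : V → A` subject to `ψ φ v ∈ S (c φ v)`. The map `c φ` is recovered
from its values on a sparse set, namely a packing together with the exceptional points, so it
contributes only the factor `N`; the choices of `ψ φ` contribute the factor `K`. -/
theorem card_le_of_approximately_equivariant {G V Z C Q A : Type*} [Group G] [Fintype V]
    [MulAction G C] (τ : G → Equiv.Perm V) (F : Finset G) (hF : F.Nonempty)
    (E : Finset Z) (c : Z → V → C) (q : Z → V → Q) (ψ : Z → V → A) (S : C → Finset A)
    (bad : Z → Finset V) (nonfree : Finset V)
    (hfree : ∀ v ∉ nonfree, Set.InjOn (fun s => τ s v) F)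
    (hc : ∀ φ ∈ E, ∀ v ∉ bad φ, ∀ s ∈ F, c φ (τ s v) = s • c φ v)
    (hψ : ∀ φ ∈ E, ∀ v, ψ φ v ∈ S (c φ v))
    (hinj : ∀ φ ∈ E, ∀ φ' ∈ E, ψ φ = ψ φ' →
      (∀ v, v ∈ bad φ ∨ v ∈ bad φ' → q φ v = q φ' v) → φ = φ')
    {β N K : ℝ} (hN : ∀ s : Finset (V → Option (C × Bool × Q)),
      (∀ g ∈ s, ((Finset.univ.filter fun v => g v ≠ none).card : ℝ) ≤ β * Fintype.card V) →
      (s.card : ℝ) ≤ N)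
    (hK0 : 0 ≤ K) (hK : ∀ φ ∈ E, ∏ v, ((S (c φ v)).card : ℝ) ≤ K)
    (hβ0 : 0 ≤ β) (hFβ : 3 ≤ β * F.card)
    (hnonfree : (nonfree.card : ℝ) ≤ β / 3 * Fintype.card V)
    (hbad : ∀ φ ∈ E, ((bad φ).card : ℝ) ≤ β / 3 * Fintype.card V) :
    (E.card : ℝ) ≤ N * K := by
  classical
  have hpack : ∀ P : Finset V, ∃ W : Finset V, (∀ v ∈ P, v ∉ nonfree) →
      W ⊆ P ∧ W.card * F.card ≤ Fintype.card V ∧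
      ∀ v ∈ P, ∃ w ∈ W, ∃ s ∈ F, ∃ t ∈ F, τ s v = τ t w := by
    intro P
    by_cases h : ∀ v ∈ P, v ∉ nonfree
    · obtain ⟨W, hW⟩ := exists_packing (fun s v => τ s v) F hF P fun v hv => hfree v (h v hv)
      exact ⟨W, fun _ => hW⟩
    · exact ⟨∅, fun h' => absurd h' h⟩
  choose W hW using hpack
  let P : Z → Finset V := fun φ => (bad φ ∪ nonfree)ᶜ
  have hP : ∀ φ, ∀ v ∈ P φ, v ∉ bad φ ∧ v ∉ nonfree := by
    intro φ v hv
    simpa [P] using hv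
  have hWP := fun φ => hW (P φ) fun v hv => (hP φ v hv).2
  -- The flag records which points of the domain belong to the packing; there `c φ` is equivariant.
  let code : Z → V → Option (C × Bool × Q) := fun φ v =>
    if v ∈ W (P φ) ∪ (bad φ ∪ nonfree) then some (c φ v, decide (v ∈ W (P φ)), q φ v) else none
  have hcode_ne : ∀ φ v, code φ v ≠ none ↔ v ∈ W (P φ) ∪ (bad φ ∪ nonfree) := by
    intro φ v
    by_cases h : v ∈ W (P φ) ∪ (bad φ ∪ nonfree)
    · simp only [code, if_pos h, h]; simp
    · simp only [code, if_neg h, h]; simp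
  have hcode_some : ∀ φ φ', code φ = code φ' → ∀ v, v ∈ W (P φ) ∪ (bad φ ∪ nonfree) →
      c φ v = c φ' v ∧ (v ∈ W (P φ) ↔ v ∈ W (P φ')) ∧ q φ v = q φ' v := by
    intro φ φ' h v hv
    have hv' : v ∈ W (P φ') ∪ (bad φ' ∪ nonfree) := by
      rw [← hcode_ne, ← h, hcode_ne]; exact hv
    have := congrFun h v
    simp only [code, if_pos hv, if_pos hv', Option.some.injEq, Prod.mk.injEq,
      decide_eq_decide] at this
    exact this
  have hcode_c : ∀ φ ∈ E, ∀ φ' ∈ E, code φ = code φ' → c φ = c φ' := by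
    intro φ hφ φ' hφ' h
    funext v
    by_cases hv : v ∈ W (P φ) ∪ (bad φ ∪ nonfree)
    · exact (hcode_some φ φ' h v hv).1
    · have hv' : v ∉ W (P φ') ∪ (bad φ' ∪ nonfree) := by
        rw [← hcode_ne, ← h, hcode_ne]; exact hv
      have hvP : v ∈ P φ := by
        simp only [Finset.mem_union, not_or] at hv
        simp [P, hv.2]
      have hvb : v ∉ bad φ' := by
        simp only [Finset.mem_union, not_or] at hv'
        exact hv'.2.1
      obtain ⟨w, hw, s, hs, t, ht, hst⟩ := (hWP φ).2.2 v hvP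
      have hwu : w ∈ W (P φ) ∪ (bad φ ∪ nonfree) := Finset.mem_union_left _ hw
      obtain ⟨h1, h2, -⟩ := hcode_some φ φ' h w hwu
      have e1 := hc φ hφ v (hP φ v hvP).1 s hs
      have e2 := hc φ hφ w (hP φ w ((hWP φ).1 hw)).1 t ht
      have e3 := hc φ' hφ' v hvb s hs
      have e4 := hc φ' hφ' w (hP φ' w ((hWP φ').1 (h2.1 hw))).1 t ht
      rw [hst, e2] at e1
      rw [hst, e4] at e3
      rw [← h1, e1] at e3
      exact smul_left_cancel s e3
  have hfiber : ∀ g ∈ E.image code, ((E.filter fun φ => code φ = g).card : ℝ) ≤ K := by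
    intro g hg
    obtain ⟨φ₀, hφ₀, rfl⟩ := Finset.mem_image.1 hg
    refine le_trans ?_ (hK φ₀ hφ₀)
    rw [← Nat.cast_prod, ← Fintype.card_piFinset]
    norm_cast
    refine Finset.card_le_card_of_injOn ψ (fun φ hφ => ?_) fun φ hφ φ' hφ' h => ?_
    · rw [Finset.mem_coe, Finset.mem_filter] at hφ
      rw [Finset.mem_coe, Fintype.mem_piFinset]
      intro v
      rw [← hcode_c φ hφ.1 φ₀ hφ₀ hφ.2]
      exact hψ φ hφ.1 v
    · rw [Finset.mem_coe, Finset.mem_filter] at hφ hφ'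
      have hcc : code φ = code φ' := hφ.2.trans hφ'.2.symm
      refine hinj φ hφ.1 φ' hφ'.1 h fun v hv => ?_
      rcases hv with hv | hv
      · exact (hcode_some φ φ' hcc v (by simp [hv])).2.2
      · exact (hcode_some φ' φ hcc.symm v (by simp [hv])).2.2.symm
  have himage : ((E.image code).card : ℝ) ≤ N := by
    refine hN _ fun g hg => ?_
    obtain ⟨φ, hφ, rfl⟩ := Finset.mem_image.1 hg
    have h1 : (Finset.univ.filter fun v => code φ v ≠ none) = W (P φ) ∪ (bad φ ∪ nonfree) := by
      ext v
      rw [Finset.mem_filter, hcode_ne]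
      simp
    rw [h1]
    have h2 : (((W (P φ) ∪ (bad φ ∪ nonfree)).card : ℕ) : ℝ)
        ≤ (W (P φ)).card + ((bad φ).card + nonfree.card) := by
      norm_cast
      exact (Finset.card_union_le _ _).trans (Nat.add_le_add_left (Finset.card_union_le _ _) _)
    have h3 : ((W (P φ)).card : ℝ) * F.card ≤ Fintype.card V := by
      exact_mod_cast (hWP φ).2.1
    have h4 : ((W (P φ)).card : ℝ) ≤ β / 3 * Fintype.card V := by
      have := mul_le_mul_of_nonneg_left hFβ (Nat.cast_nonneg (α := ℝ) (W (P φ)).card)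
      have := mul_le_mul_of_nonneg_left h3 hβ0
      linarith
    linarith [hbad φ hφ]
  calc (E.card : ℝ) = ∑ g ∈ E.image code, ((E.filter fun φ => code φ = g).card : ℝ) := by
        rw [Finset.card_eq_sum_card_image code E]; push_cast; rfl
    _ ≤ (E.image code).card • K := Finset.sum_le_card_nsmul _ _ _ hfiber
    _ = (E.image code).card * K := nsmul_eq_mul _ _
    _ ≤ N * K := mul_le_mul_of_nonneg_right himage hK0

/-! ### Symbol profiles of points of the orbit closure -/

section Profile

variable {G : Type*} [Group G] {k : ℕ}

open Classical in
/-- The sets of symbols that `z` takes on the cosets of `H`, seen through the finite window `F`. -/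
noncomputable def profile (H : Subgroup G) (F : Finset G) (z : FullShift G k) : G ⧸ H → Finset (Fin k) :=
  fun w => (F.filter fun g : G => (g : G ⧸ H) = w).image fun g => z g

theorem mem_profile {H : Subgroup G} {F : Finset G} {z : FullShift G k} {w : G ⧸ H} {a : Fin k} :
    a ∈ profile H F z w ↔ ∃ g ∈ F, (g : G ⧸ H) = w ∧ z g = a := by
  simp [profile, and_assoc]

theorem profile_congr {H : Subgroup G} {F : Finset G} {y z : FullShift G k}
    (h : ∀ g ∈ F, y g = z g) : profile H F y = profile H F z := by
  funext w
  ext a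
  simp only [mem_profile]
  exact exists_congr fun g => and_congr_right fun hg => by rw [h g hg]

/-- A window is complete for `x` if it shows all symbols on every coset, for every translate
of `x`. -/
def IsCompleteWindow (H : Subgroup G) (F : Finset G) (x : FullShift G k) : Prop :=
  ∀ g u : G, ∃ f ∈ F, (f : G ⧸ H) = (u : G ⧸ H) ∧ (g • x) f = (g • x) u

theorem perPart_mono {A : Type*} {H K : Subgroup G} (h : K ≤ H) (y : G → A) :
    perPart H y ⊆ perPart K y :=
  fun _ hg u hu => hg u (h hu)

/-- Finitely many positions witness all symbols on all cosets of `H m`. These positions are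
periodic under some `H n`, so the pattern they carry recurs in every translate of `x` within
bounded distance. -/
theorem exists_isCompleteWindow (H : ℕ → Subgroup G) [∀ n, (H n).Normal]
    [∀ n, (H n).FiniteIndex] (hanti : Antitone H) {x : FullShift G k} (hx : IsToeplitz H x)
    (m : ℕ) : ∃ F : Finset G, IsCompleteWindow (H m) F x := by
  classical
  let f : G → (G ⧸ H m) × Fin k := fun u => (u, x u)
  let D : Finset G := (Set.toFinite (Set.range (Function.invFun f))).toFinset
  have hD : ∀ u : G, ∃ d ∈ D, (d : G ⧸ H m) = u ∧ x d = x u := by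
    intro u
    refine ⟨Function.invFun f (f u), by simp [D], ?_⟩
    have : f (Function.invFun f (f u)) = f u := Function.invFun_eq ⟨u, rfl⟩
    exact ⟨congrArg Prod.fst this, congrArg Prod.snd this⟩
  have hper : ∀ d : G, ∃ n, d ∈ perPart (H n) x := by
    intro d
    have : d ∈ ⋃ n, perPart (H n) x := by rw [hx]; trivial
    simpa using this
  choose N hN using hper
  set n := max m (D.sup N) with hn
  have hDn : ∀ d ∈ D, d ∈ perPart (H n) x := fun d hd =>
    perPart_mono (hanti ((Finset.le_sup hd).trans (le_max_right _ _))) _ (hN d)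
  let R : Finset G := (Set.toFinite (Set.range fun w : G ⧸ H n => (Quotient.out w : G))).toFinset
  refine ⟨(R ×ˢ D).image fun p => p.1 * p.2, fun g u => ?_⟩
  obtain ⟨d, hd, hdu, hxd⟩ := hD (g⁻¹ * u)
  set r : G := Quotient.out (g : G ⧸ H n) with hr
  have hrg : r⁻¹ * g ∈ H n := QuotientGroup.eq.1 (Quotient.out_eq' (g : G ⧸ H n))
  refine ⟨r * d, Finset.mem_image.2 ⟨(r, d), by simp [R, hd, hr], rfl⟩, ?_, ?_⟩
  · have h1 : r⁻¹ * g ∈ H m := hanti (le_max_left _ _) hrg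
    rw [QuotientGroup.eq] at hdu ⊢
    -- `(r d)⁻¹ u = (d⁻¹ (r⁻¹ g) d) (d⁻¹ g⁻¹ u)`
    have h2 : d⁻¹ * (r⁻¹ * g) * d ∈ H m := by
      simpa using (inferInstance : (H m).Normal).conj_mem _ h1 d⁻¹
    have h3 := (H m).mul_mem h2 hdu
    convert h3 using 1
    group
  · rw [FullShift.smul_apply, FullShift.smul_apply, ← hxd]
    have := hDn d hd (r⁻¹ * g) hrg
    convert this using 2
    group

theorem exists_smul_eqOn {x z : FullShift G k} (hz : z ∈ orbitClosure (G := G) x)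
    (F : Finset G) : ∃ g : G, ∀ u ∈ F, (g • x) u = z u := by
  have hopen : IsOpen {y : FullShift G k | ∀ u ∈ F, y u = z u} := by
    have : {y : FullShift G k | ∀ u ∈ F, y u = z u}
        = ⋂ u ∈ F, (fun y : FullShift G k => y u) ⁻¹' {z u} := by
      ext; simp
    rw [this]
    exact isOpen_biInter_finset fun u _ =>
      (isOpen_discrete _).preimage (continuous_apply (A := fun _ : G => Fin k) u)
  obtain ⟨y, hy, g, rfl⟩ := mem_closure_iff.1 (show z ∈ closure (MulAction.orbit G x) from hz)
    _ hopen fun _ _ => rfl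
  exact ⟨g, hy⟩

variable {H : Subgroup G} {F : Finset G} {x z : FullShift G k}

theorem IsCompleteWindow.mem_profile_smul (hF : IsCompleteWindow H F x) {g : G} {w : G ⧸ H}
    {a : Fin k} :
    a ∈ profile H F (g • x) w ↔ ∃ u : G, (u : G ⧸ H) = w ∧ (g • x) u = a := by
  rw [mem_profile]
  constructor
  · rintro ⟨u, -, h⟩
    exact ⟨u, h⟩
  · rintro ⟨u, rfl, rfl⟩
    exact hF g u

theorem IsCompleteWindow.apply_one_mem_profile (hF : IsCompleteWindow H F x)
    (hz : z ∈ orbitClosure (G := G) x) : z 1 ∈ profile H F z ((1 : G) : G ⧸ H) := by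
  classical
  obtain ⟨g, hg⟩ := exists_smul_eqOn hz (insert 1 F)
  rw [← profile_congr fun u hu => hg u (Finset.mem_insert_of_mem hu), hF.mem_profile_smul]
  exact ⟨1, rfl, hg 1 (Finset.mem_insert_self _ _)⟩

theorem IsCompleteWindow.profile_smul (hF : IsCompleteWindow H F x)
    (hz : z ∈ orbitClosure (G := G) x) (t : G) (w : G ⧸ H) :
    profile H F (t • z) w = profile H F z (t⁻¹ • w) := by
  classical
  obtain ⟨g, hg⟩ := exists_smul_eqOn hz (F ∪ F.image fun u => t⁻¹ * u)
  have h1 : profile H F (t • z) = profile H F ((t * g) • x) := profile_congr fun u hu => by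
    rw [mul_smul, FullShift.smul_apply, FullShift.smul_apply t, hg]
    exact Finset.mem_union_right _ (Finset.mem_image_of_mem _ hu)
  rw [h1, ← profile_congr fun u hu => hg u (Finset.mem_union_left _ hu)]
  ext a
  rw [hF.mem_profile_smul, hF.mem_profile_smul]
  constructor
  · rintro ⟨u, rfl, rfl⟩
    exact ⟨t⁻¹ * u, rfl, by rw [mul_smul, FullShift.smul_apply t]⟩
  · rintro ⟨u, hu, rfl⟩
    refine ⟨t * u, ?_, by rw [mul_smul, FullShift.smul_apply t, inv_mul_cancel_left]⟩
    rw [← smul_inv_smul t w, ← hu]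
    rfl

theorem IsCompleteWindow.card_profile_smul (hF : IsCompleteWindow H F x) (g : G) (w : G ⧸ H) :
    (profile H F (g • x) w).card = cosetSymbols H x (g⁻¹ • w) := by
  rw [← Set.ncard_coe_finset]
  refine congrArg Set.ncard ?_
  ext a
  rw [Finset.mem_coe, hF.mem_profile_smul]
  constructor
  · rintro ⟨u, rfl, rfl⟩
    exact ⟨g⁻¹ * u, rfl, rfl⟩
  · rintro ⟨u, hu, rfl⟩
    refine ⟨g * u, ?_, by rw [FullShift.smul_apply, inv_mul_cancel_left]⟩
    rw [← smul_inv_smul g w, ← hu]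
    rfl

/-- The profile of any point of the orbit closure is a translate of that of `x`. -/
theorem IsCompleteWindow.sum_log_card_profile [H.FiniteIndex] [Fintype (G ⧸ H)]
    (hF : IsCompleteWindow H F x) (hz : z ∈ orbitClosure (G := G) x) :
    ∑ w, Real.log (profile H F z w).card = H.index * cosetEntropy H x := by
  obtain ⟨g, hg⟩ := exists_smul_eqOn hz F
  have hdef : cosetEntropy H x
      = 1 / (H.index : ℝ) * ∑ᶠ w : G ⧸ H, Real.log (cosetSymbols H x w) := rfl
  rw [← profile_congr hg, hdef, finsum_eq_sum_of_fintype, ← mul_assoc,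
    mul_one_div_cancel (by exact_mod_cast Subgroup.FiniteIndex.index_ne_zero), one_mul]
  simp only [hF.card_profile_smul]
  exact Equiv.sum_comp (MulAction.toPerm g⁻¹) fun w : G ⧸ H => Real.log (cosetSymbols H x w)

end Profile

/-! ### Windows and pseudometrics on the orbit closure -/

section Windows

variable {G : Type*} [Group G] {k : ℕ} {x : FullShift G k}

instance : CompactSpace (FullShift G k) := inferInstanceAs (CompactSpace (G → Fin k))

instance : CompactSpace (orbitClosure (G := G) x) :=
  isCompact_iff_compactSpace.1 (isClosed_closure (s := MulAction.orbit G x)).isCompact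

instance : ContinuousConstSMul G (orbitClosure (G := G) x) where
  continuous_const_smul g :=
    ((continuous_const_smul g).comp continuous_subtype_val).subtype_mk _

theorem isClopen_setOf_apply_eq (g : G) :
    IsClopen {p : orbitClosure (G := G) x × orbitClosure (G := G) x |
      (p.1 : FullShift G k) g = (p.2 : FullShift G k) g} := by
  have h : Continuous fun y : orbitClosure (G := G) x => (y : FullShift G k) g := by
    have h1 : Continuous fun y : FullShift G k => y g :=
      continuous_apply (A := fun _ : G => Fin k) g
    exact h1.comp continuous_subtype_val
  have h2 := (h.comp continuous_fst).prodMk (h.comp continuous_snd)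
  exact (isClopen_discrete {p : Fin k × Fin k | p.1 = p.2}).preimage h2

variable {d : orbitClosure (G := G) x → orbitClosure (G := G) x → ℝ}

theorem exists_window_dist_lt (hd : IsContinuousPseudometric d) {ε : ℝ} (hε : 0 < ε) :
    ∃ W : Finset G, ∀ y z : orbitClosure (G := G) x,
      (∀ g ∈ W, (y : FullShift G k) g = (z : FullShift G k) g) → d y z < ε := by
  have hK : IsCompact {p : orbitClosure (G := G) x × orbitClosure (G := G) x | ε ≤ d p.1 p.2} :=
    (isClosed_le continuous_const hd.continuous).isCompact
  obtain ⟨W, hW⟩ := hK.elim_finite_subfamily_closed _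
    (fun g : G => (isClopen_setOf_apply_eq (x := x) g).isClosed) (by
      rw [Set.eq_empty_iff_forall_notMem]
      rintro ⟨y, z⟩ ⟨h1, h2⟩
      have hyz : y = z := Subtype.ext (funext fun g => Set.mem_iInter.1 h2 g)
      subst hyz
      have h3 : ε ≤ d y y := h1
      rw [hd.self] at h3
      exact hε.not_ge h3)
  refine ⟨W, fun y z h => ?_⟩
  by_contra hcon
  have : (y, z) ∈ (∅ : Set (orbitClosure (G := G) x × orbitClosure (G := G) x)) :=
    hW ▸ ⟨not_lt.1 hcon, Set.mem_iInter₂.2 h⟩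
  exact this

theorem exists_dist_lt_imp_eqOn (hd : IsContinuousPseudometric d) (hgen : IsDynamicallyGenerating G d) (D : Finset G) :
    ∃ (F : Finset G) (δ : ℝ), 0 < δ ∧ ∀ y z : orbitClosure (G := G) x,
      (∀ s ∈ F, d (s • y) (s • z) < δ) →
      ∀ g ∈ D, (y : FullShift G k) g = (z : FullShift G k) g := by
  classical
  have hK : IsCompact (⋂ g ∈ D, {p : orbitClosure (G := G) x × orbitClosure (G := G) x |
      (p.1 : FullShift G k) g = (p.2 : FullShift G k) g})ᶜ :=
    (isOpen_biInter_finset fun g _ => (isClopen_setOf_apply_eq g).isOpen).isClosed_compl.isCompact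
  obtain ⟨u, hu⟩ := hK.elim_finite_subfamily_closed
    (fun i : G × ℕ => {p : orbitClosure (G := G) x × orbitClosure (G := G) x |
      d (i.1 • p.1) (i.1 • p.2) ≤ 1 / ((i.2 : ℝ) + 1)})
    (fun i => isClosed_le (hd.continuous.comp
      (((continuous_const_smul i.1).comp continuous_fst).prodMk
        ((continuous_const_smul i.1).comp continuous_snd))) continuous_const) (by
      rw [Set.eq_empty_iff_forall_notMem]
      rintro ⟨y, z⟩ ⟨h1, h2⟩
      have hyz : y ≠ z := by
        rintro rfl
        exact h1 (Set.mem_iInter₂.2 fun _ _ => rfl)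
      obtain ⟨s, hs⟩ := hgen y z hyz
      obtain ⟨n, hn⟩ := exists_nat_one_div_lt hs
      exact hn.not_ge (Set.mem_iInter.1 h2 (s, n)))
  refine ⟨u.image Prod.fst, 1 / ((u.sup Prod.snd : ℕ) + 1 : ℝ), by positivity,
    fun y z h => ?_⟩
  by_contra hcon
  have : (y, z) ∈ (∅ : Set (orbitClosure (G := G) x × orbitClosure (G := G) x)) := by
    rw [← hu]
    refine ⟨fun h' => hcon fun g hg => Set.mem_iInter₂.1 h' g hg, Set.mem_iInter₂.2 ?_⟩
    intro i hi
    refine (h i.1 (Finset.mem_image_of_mem _ hi)).le.trans ?_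
    have h4 : ((i.2 : ℕ) : ℝ) ≤ (u.sup Prod.snd : ℕ) := by
      exact_mod_cast Finset.le_sup (f := Prod.snd) hi
    exact one_div_le_one_div_of_le (by positivity) (by linarith)
  exact this

end Windows

/-! ### Approximately equivariant maps -/

section Sofic

theorem card_filter_exists_le {ι V : Type*} [Fintype V] (I : Finset ι) (p : ι → V → Prop)
    [∀ i, DecidablePred (p i)] [DecidablePred fun v => ∃ i ∈ I, p i v] {b : ℝ}
    (h : ∀ i ∈ I, ((Finset.univ.filter (p i)).card : ℝ) ≤ b) :
    ((Finset.univ.filter fun v => ∃ i ∈ I, p i v).card : ℝ) ≤ I.card * b := by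
  classical
  have h1 : (Finset.univ.filter fun v => ∃ i ∈ I, p i v)
      = I.biUnion fun i => Finset.univ.filter (p i) := by
    ext v; simp
  rw [h1]
  calc ((I.biUnion fun i => Finset.univ.filter (p i)).card : ℝ)
      ≤ ∑ i ∈ I, ((Finset.univ.filter (p i)).card : ℝ) := by
        exact_mod_cast Finset.card_biUnion_le
    _ ≤ I.card • b := Finset.sum_le_card_nsmul _ _ _ h
    _ = I.card * b := nsmul_eq_mul _ _

theorem card_filter_or_or_le {V : Type*} [Fintype V] (p q r : V → Prop) [DecidablePred p]
    [DecidablePred q] [DecidablePred r] [DecidablePred fun v => p v ∨ q v ∨ r v] :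
    ((Finset.univ.filter fun v => p v ∨ q v ∨ r v).card : ℝ) ≤
      (Finset.univ.filter p).card + (Finset.univ.filter q).card + (Finset.univ.filter r).card := by
  classical
  have h : (Finset.univ.filter fun v => p v ∨ q v ∨ r v)
      = Finset.univ.filter p ∪ (Finset.univ.filter q ∪ Finset.univ.filter r) := by
    ext v; simp
  rw [h, add_assoc]
  exact_mod_cast (Finset.card_union_le (Finset.univ.filter p) _).trans
    (Nat.add_le_add_left (Finset.card_union_le _ _) _)

theorem eventually_card_filter_not_le {V : ℕ → Type*} [∀ n, Fintype (V n)] {p : ∀ n, V n → Prop}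
    [∀ n, DecidablePred fun v => ¬ p n v]
    (h : Tendsto (fun n => ({v : V n | p n v}.ncard : ℝ) / (Fintype.card (V n) : ℝ)) atTop (𝓝 1))
    {β : ℝ} (hβ : 0 < β) :
    ∀ᶠ n in atTop,
      ((Finset.univ.filter fun v => ¬ p n v).card : ℝ) ≤ β * Fintype.card (V n) := by
  classical
  filter_upwards [h.eventually_const_lt (show 1 - β < 1 by linarith)] with n hn
  have h1 : ((Finset.univ.filter fun v => p n v).card : ℝ)
      + (Finset.univ.filter fun v => ¬ p n v).card = Fintype.card (V n) := by
    exact_mod_cast Finset.card_filter_add_card_filter_not (s := Finset.univ) (p n)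
  have h2 : {v : V n | p n v}.ncard = (Finset.univ.filter fun v => p n v).card := by
    rw [← Set.ncard_coe_finset]; simp
  rw [h2] at hn
  rcases (Nat.cast_nonneg (α := ℝ) (Fintype.card (V n))).eq_or_lt with h0 | h0
  · rw [← h0] at h1 ⊢
    have := Nat.cast_nonneg (α := ℝ) (Finset.univ.filter fun v => p n v).card
    linarith
  · rw [lt_div_iff₀ h0] at hn
    linarith

variable {G : Type*} [Group G] {V : ℕ → Type*} [∀ n, Fintype (V n)]
  {σ : ∀ n, G → Equiv.Perm (V n)}

theorem IsSoficApproximation.eventually_card_pos (hσ : IsSoficApproximation V σ) :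
    ∀ᶠ n in atTop, 0 < Fintype.card (V n) := by
  filter_upwards [(hσ.multiplicative 1 1).eventually_const_lt one_pos] with n hn
  by_contra h0
  have h1 : Fintype.card (V n) = 0 := by omega
  rw [h1, Nat.cast_zero, div_zero] at hn
  exact lt_irrefl _ hn

open Classical in
theorem IsSoficApproximation.eventually_card_not_injOn_le (hσ : IsSoficApproximation V σ)
    (F : Finset G) {β : ℝ} (hβ : 0 < β) :
    ∀ᶠ n in atTop, ((Finset.univ.filter fun v =>
      ¬ Set.InjOn (fun s => σ n s v) F).card : ℝ) ≤ β * Fintype.card (V n) := by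
  set I := F.offDiag with hI
  have hev : ∀ᶠ n in atTop, ∀ i ∈ I, ((Finset.univ.filter fun v =>
      ¬ (σ n i.2 v ≠ σ n i.1 v)).card : ℝ) ≤ β / (I.card + 1) * Fintype.card (V n) := by
    rw [Filter.eventually_all_finset]
    intro i hi
    exact eventually_card_filter_not_le (hσ.free i.1 i.2 (Finset.mem_offDiag.1 hi).2.2)
      (show 0 < β / (I.card + 1) by positivity)
  filter_upwards [hev] with n hn
  have h1 := card_filter_exists_le I _ hn
  refine le_trans ?_ (h1.trans ?_)
  · norm_cast
    refine Finset.card_le_card fun v hv => ?_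
    replace hv := (Finset.mem_filter.1 hv).2
    rw [Set.InjOn] at hv
    push Not at hv
    obtain ⟨s, hs, t, ht, h, hst⟩ := hv
    exact Finset.mem_filter.2 ⟨Finset.mem_univ _, (s, t), Finset.mem_offDiag.2 ⟨hs, ht, hst⟩,
      not_not.2 h.symm⟩
  · rw [← mul_assoc]
    refine mul_le_mul_of_nonneg_right ?_ (Nat.cast_nonneg _)
    rw [mul_div_assoc', div_le_iff₀ (by positivity)]
    linarith

open Classical in
/-- Chebyshev's inequality for the normalized `ℓ²` pseudometric. -/
theorem card_filter_le_of_dTwo_le {X W : Type*} [Fintype W] {d : X → X → ℝ} {φ ψ : W → X}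
    {θ δ : ℝ} (hθ : 0 < θ) (h : dTwo d φ ψ ≤ δ) :
    ((Finset.univ.filter fun v => θ ≤ d (φ v) (ψ v)).card : ℝ)
      ≤ δ ^ 2 / θ ^ 2 * Fintype.card W := by
  rcases Nat.eq_zero_or_pos (Fintype.card W) with h0 | h0
  · have := (Finset.card_le_univ (Finset.univ.filter fun v => θ ≤ d (φ v) (ψ v))).trans h0.le
    rw [Nat.le_zero.1 this, h0]; simp
  have hW : (0 : ℝ) < Fintype.card W := by exact_mod_cast h0
  have hδ : 0 ≤ δ := (Real.sqrt_nonneg _).trans h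
  rw [dTwo, Real.sqrt_le_left hδ, one_div, inv_mul_le_iff₀ hW] at h
  have h1 : ((Finset.univ.filter fun v => θ ≤ d (φ v) (ψ v)).card : ℝ) * θ ^ 2
      ≤ ∑ v, d (φ v) (ψ v) ^ 2 := by
    rw [← nsmul_eq_mul]
    refine (Finset.card_nsmul_le_sum _ _ _ fun v hv => ?_).trans
      (Finset.sum_le_sum_of_subset_of_nonneg (Finset.subset_univ _) fun _ _ _ => sq_nonneg _)
    exact pow_le_pow_left₀ hθ.le (Finset.mem_filter.1 hv).2 2
  rw [div_mul_eq_mul_div, le_div_iff₀ (by positivity)]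
  linarith

/-- A relation `R` that holds whenever `d` is small along finitely many translates holds between
`φ (σ t v)` and `t • φ v` for most `v`, if `φ` is sufficiently equivariant. -/
theorem IsSoficApproximation.exists_card_not_rel_le {X : Type*} [TopologicalSpace X]
    [MulAction G X] (hσ : IsSoficApproximation V σ) {d : X → X → ℝ}
    (hd : IsContinuousPseudometric d) {R : X → X → Prop} {F₀ : Finset G} {δ₀ : ℝ} (hδ₀ : 0 < δ₀)
    (hR : ∀ y z, (∀ s ∈ F₀, d (s • y) (s • z) < δ₀) → R y z) (T : Finset G) {β : ℝ}
    (hβ : 0 < β) :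
    ∃ (F : Finset G) (δ : ℝ), 0 < δ ∧ ∀ᶠ n in atTop, ∀ φ ∈ soficMap d F δ (σ n),
      ∃ bad : Finset (V n), (bad.card : ℝ) ≤ β * Fintype.card (V n) ∧
        ∀ v ∉ bad, ∀ t ∈ T, R (φ (σ n t v)) (t • φ v) := by
  classical
  set I := F₀ ×ˢ T with hI
  set β' := β / (3 * (I.card + 1)) with hβ'
  have hβ'0 : 0 < β' := by positivity
  have hev : ∀ᶠ n in atTop, ∀ i ∈ I, ((Finset.univ.filter fun v =>
      ¬ (σ n (i.1 * i.2) v = σ n i.1 (σ n i.2 v))).card : ℝ) ≤ β' * Fintype.card (V n) := by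
    rw [Filter.eventually_all_finset]
    exact fun i _ => eventually_card_filter_not_le (hσ.multiplicative i.1 i.2) hβ'0
  refine ⟨F₀ ∪ I.image fun i => i.1 * i.2, δ₀ / 2 * √β', by positivity, ?_⟩
  filter_upwards [hev] with n hn φ hφ
  have hcheb : ∀ s ∈ F₀ ∪ I.image fun i => i.1 * i.2,
      ((Finset.univ.filter fun v => δ₀ / 2 ≤ d (φ (σ n s v)) (s • φ v)).card : ℝ)
        ≤ β' * Fintype.card (V n) := by
    intro s hs
    refine (card_filter_le_of_dTwo_le (half_pos hδ₀) (hφ s hs)).trans_eq ?_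
    rw [mul_pow, Real.sq_sqrt hβ'0.le, mul_div_cancel_left₀ _ (by positivity)]
  have hunion := card_filter_exists_le I (fun i v =>
      δ₀ / 2 ≤ d (φ (σ n (i.1 * i.2) v)) ((i.1 * i.2) • φ v) ∨
      ¬ (σ n (i.1 * i.2) v = σ n i.1 (σ n i.2 v)) ∨
      δ₀ / 2 ≤ d (φ (σ n i.1 (σ n i.2 v))) (i.1 • φ (σ n i.2 v)))
    (b := 3 * β' * Fintype.card (V n)) (by
      intro i hi
      have h1 := hcheb (i.1 * i.2)
        (Finset.mem_union_right _ (Finset.mem_image_of_mem (fun i : G × G => i.1 * i.2) hi))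
      have h2 := hn i hi
      have h3 := hcheb i.1 (Finset.mem_union_left _ (Finset.mem_product.1 hi).1)
      have h4 : (Finset.univ.filter fun v =>
            δ₀ / 2 ≤ d (φ (σ n i.1 (σ n i.2 v))) (i.1 • φ (σ n i.2 v))).card
          ≤ (Finset.univ.filter fun v => δ₀ / 2 ≤ d (φ (σ n i.1 v)) (i.1 • φ v)).card :=
        Finset.card_le_card_of_injOn (σ n i.2) (fun v hv => by simpa using hv)
          (σ n i.2).injective.injOn
      have h4' := (Nat.cast_le (α := ℝ)).2 h4
      refine (card_filter_or_or_le (V := V n) _ _ _).trans ?_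
      linarith)
  refine ⟨_, hunion.trans ?_, fun v hv t ht => hR _ _ fun s hs => ?_⟩
  rotate_left
  · simp only [Finset.mem_filter, Finset.mem_univ, true_and] at hv
    have hst := not_exists.1 hv (s, t)
    simp only [hI, Finset.mem_product, hs, ht, true_and, not_or, not_not, not_le] at hst
    obtain ⟨h1, h2, h3⟩ := hst
    rw [h2, mul_smul] at h1
    have h4 := hd.triangle (s • φ (σ n t v)) (φ (σ n s (σ n t v))) (s • t • φ v)
    rw [hd.symm (s • φ (σ n t v)) (φ (σ n s (σ n t v)))] at h4
    linarith
  · rw [← mul_assoc]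
    refine mul_le_mul_of_nonneg_right ?_ (Nat.cast_nonneg _)
    rw [hβ', ← mul_assoc, mul_div_assoc', div_le_iff₀ (by positivity)]
    nlinarith

end Sofic

/-! ### The upper bound for infinite groups -/

section Bound

theorem sum_le_of_sum_perm_le {V ι : Type*} [Fintype V] [Fintype ι] [Nonempty ι]
    (ρ : ι → Equiv.Perm V) (f : V → ℝ) {a b : ℝ} (ha : 0 ≤ a) (hb : ∀ v, f v ≤ b)
    (bad : Finset V) (h : ∀ v ∉ bad, ∑ i, f (ρ i v) ≤ Fintype.card ι * a) :
    ∑ v, f v ≤ Fintype.card V * a + bad.card * b := by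
  classical
  have hι : (0 : ℝ) < Fintype.card ι := by exact_mod_cast Fintype.card_pos
  have h1 : Fintype.card ι * ∑ v, f v = ∑ v, ∑ i, f (ρ i v) := by
    rw [Finset.sum_comm]
    simp only [Equiv.sum_comp]
    rw [Finset.sum_const, Finset.card_univ, nsmul_eq_mul]
  have h2 : ∀ v, ∑ i, f (ρ i v)
      ≤ Fintype.card ι * a + if v ∈ bad then Fintype.card ι * b else 0 := by
    intro v
    split_ifs with hv
    · have : ∑ i, f (ρ i v) ≤ Fintype.card ι * b := by
        refine (Finset.sum_le_card_nsmul _ _ b fun i _ => hb _).trans_eq ?_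
        rw [Finset.card_univ, nsmul_eq_mul]
      have : 0 ≤ Fintype.card ι * a := by positivity
      linarith
    · rw [add_zero]; exact h v hv
  have h3 := Finset.sum_le_sum fun v (_ : v ∈ Finset.univ) => h2 v
  rw [← h1, Finset.sum_add_distrib, Finset.sum_const, Finset.card_univ, nsmul_eq_mul,
    ← Finset.sum_filter, Finset.sum_const, nsmul_eq_mul,
    Finset.filter_univ_mem] at h3
  refine le_of_mul_le_mul_left (h3.trans_eq ?_) hι
  ring

theorem log_sepNumber_div_le {Z : Type*} {ρ : Z → Z → ℝ} {ε : ℝ} {Y : Set Z} {N : ℕ} (hN : 0 < N)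
    {r : ℝ} (h : ∀ E : Finset Z, (E : Set Z) ⊆ Y → (∀ y ∈ E, ∀ z ∈ E, y ≠ z → ε < ρ y z) →
      (E.card : ℝ) ≤ Real.exp (N * r)) :
    ENNReal.log ((sepNumber ρ ε Y : ℕ∞) : ℝ≥0∞) / ((N : ℝ) : EReal) ≤ (r : EReal) := by
  have h1 : sepNumber ρ ε Y ≤ (⌊Real.exp (N * r)⌋₊ : ℕ∞) :=
    iSup_le fun E => iSup₂_le fun hE hsep => by exact_mod_cast Nat.le_floor (h E hE hsep)
  have h2 : ((sepNumber ρ ε Y : ℕ∞) : ℝ≥0∞) ≤ ENNReal.ofReal (Real.exp (N * r)) := by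
    refine (ENat.toENNReal_le.2 h1).trans ?_
    rw [ENat.toENNReal_coe, ← ENNReal.ofReal_natCast]
    exact ENNReal.ofReal_le_ofReal (Nat.floor_le (Real.exp_pos _).le)
  rw [EReal.div_le_iff_le_mul (by exact_mod_cast hN) (EReal.coe_ne_top _)]
  refine (ENNReal.log_le_log h2).trans_eq ?_
  rw [ENNReal.log_ofReal_of_pos (Real.exp_pos _), Real.log_exp, EReal.coe_mul]

theorem cosetEntropy_nonneg {G A : Type*} [Group G] (H : Subgroup G) (x : G → A) :
    0 ≤ cosetEntropy H x :=
  mul_nonneg (by positivity) (finsum_nonneg fun _ => Real.log_natCast_nonneg _)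

variable {G : Type*} [Group G] {k : ℕ} {H : Subgroup G} {F : Finset G} {x : FullShift G k}
  {V : ℕ → Type*} [∀ n, Fintype (V n)] {σ : ∀ n, G → Equiv.Perm (V n)}

/-- The symbol profiles along an approximately equivariant map `φ` equidistribute over the
translates of the profile of `x`, because each `σ n t` is a bijection; hence the number of
choices for the symbols `φ v 1` is governed by the coset entropy. -/
theorem IsCompleteWindow.prod_card_profile_le [H.FiniteIndex] (hF : IsCompleteWindow H F x)
    {W : Type*} [Fintype W] (τ : G → Equiv.Perm W) (φ : W → orbitClosure (G := G) x)
    (bad : Finset W)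
    (h : ∀ v ∉ bad, ∀ w : G ⧸ H, profile H F (φ (τ (Quotient.out w)⁻¹ v) : FullShift G k)
      = profile H F ((Quotient.out w)⁻¹ • (φ v : FullShift G k))) :
    ∏ v, ((profile H F (φ v : FullShift G k) ((1 : G) : G ⧸ H)).card : ℝ)
      ≤ Real.exp (Fintype.card W * cosetEntropy H x + bad.card * Real.log k) := by
  classical
  have : Fintype (G ⧸ H) := Fintype.ofFinite _
  have hsum := sum_le_of_sum_perm_le (fun w : G ⧸ H => τ (Quotient.out w)⁻¹)
    (fun v => Real.log (profile H F (φ v : FullShift G k) ((1 : G) : G ⧸ H)).card) (b := Real.log k)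
    (cosetEntropy_nonneg H x) (fun v => by
      have h1 : (profile H F (φ v : FullShift G k) ((1 : G) : G ⧸ H)).card ≤ k :=
        (Finset.card_le_univ _).trans_eq (Fintype.card_fin k)
      rcases Nat.eq_zero_or_pos (profile H F (φ v : FullShift G k) ((1 : G) : G ⧸ H)).card with h0 | h0
      · rw [h0]; simp [Real.log_natCast_nonneg]
      · exact Real.log_le_log (by exact_mod_cast h0) (by exact_mod_cast h1)) bad (by
      intro v hv
      have h1 : ∀ w : G ⧸ H, profile H F (φ (τ (Quotient.out w)⁻¹ v) : FullShift G k) ((1 : G) : G ⧸ H)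
          = profile H F (φ v : FullShift G k) w := by
        intro w
        rw [h v hv w, hF.profile_smul (φ v).2, inv_inv]
        congr 1
        change ((Quotient.out w * 1 : G) : G ⧸ H) = w
        rw [mul_one]
        exact Quotient.out_eq' w
      simp only [h1]
      rw [hF.sum_log_card_profile (φ v).2, Subgroup.index, Nat.card_eq_fintype_card])
  refine le_trans ?_ (Real.exp_le_exp.2 hsum)
  rw [Real.exp_sum]
  exact Finset.prod_le_prod (fun _ _ => Nat.cast_nonneg _) fun v _ => Real.le_exp_log _

/-- For an infinite group and an arbitrary sofic approximation, the entropy is at most the coset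
entropy of every finite index subgroup that admits a complete window. -/
theorem IsCompleteWindow.soficEntropyOfPseudometric_le [Infinite G] [H.FiniteIndex]
    (hF : IsCompleteWindow H F x) (hσ : IsSoficApproximation V σ)
    {d : orbitClosure (G := G) x → orbitClosure (G := G) x → ℝ}
    (hd : IsContinuousPseudometric d) (hgen : IsDynamicallyGenerating G d) :
    soficEntropyOfPseudometric V σ d ≤ ((cosetEntropy H x : ℝ) : EReal) := by
  classical
  have : Fintype (G ⧸ H) := Fintype.ofFinite _
  refine iSup₂_le fun ε hε => EReal.le_of_forall_lt_iff_le.1 fun r hr => ?_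
  rw [EReal.coe_lt_coe_iff] at hr
  set η := r - cosetEntropy H x with hη
  have hη0 : 0 < η := sub_pos.2 hr
  obtain ⟨W, hW⟩ := exists_window_dist_lt hd hε
  obtain ⟨β, hβ, hsparse⟩ := exists_card_sparse_le
    ((G ⧸ H → Finset (Fin k)) × Bool × (W → Fin k)) (half_pos hη0)
  obtain ⟨P, hP⟩ := Infinite.exists_subset_card_eq G (⌈3 / β⌉₊ + 1)
  have hPβ : 3 ≤ β * P.card := by
    have h1 := Nat.le_ceil (3 / β)
    rw [div_le_iff₀ hβ] at h1
    rw [hP]; push_cast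
    nlinarith
  have hPne : P.Nonempty := Finset.card_pos.1 (by omega)
  -- equivariance along `P` recovers the profiles, along `W⁻¹` the points `φ v`, and along
  -- the coset representatives it gives equidistribution
  set T : Finset G := P ∪ (W.image fun g => g⁻¹) ∪
    Finset.univ.image fun w : G ⧸ H => (Quotient.out w : G)⁻¹ with hT
  have hlog : 0 ≤ Real.log k := Real.log_natCast_nonneg k
  set β₁ := min (β / 3) (η / (2 * (Real.log k + 1))) with hβ₁
  have hβ₁0 : 0 < β₁ := lt_min (by positivity) (by positivity)
  obtain ⟨F₀, δ₀, hδ₀, hF₀⟩ := exists_dist_lt_imp_eqOn hd hgen (insert 1 F)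
  obtain ⟨F', δ, hδ, hev⟩ := hσ.exists_card_not_rel_le hd hδ₀
    (R := fun y z => ∀ g ∈ insert 1 F, (y : FullShift G k) g = (z : FullShift G k) g) hF₀ T hβ₁0
  refine iInf_le_of_le F' (iInf₂_le_of_le δ hδ ?_)
  refine limsup_le_of_le (by isBoundedDefault) ?_
  filter_upwards [hev, hσ.eventually_card_not_injOn_le P (show 0 < β / 3 by positivity),
    hσ.eventually_card_pos] with n hn hfree hpos
  refine log_sepNumber_div_le hpos fun E hE hsep => ?_
  have hbad : ∀ φ : V n → orbitClosure (G := G) x, ∃ bad : Finset (V n), φ ∈ E →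
      (bad.card : ℝ) ≤ β₁ * Fintype.card (V n) ∧ ∀ v ∉ bad, ∀ t ∈ T, ∀ g ∈ insert 1 F,
        (φ (σ n t v) : FullShift G k) g = (t • (φ v : FullShift G k)) g := by
    intro φ
    by_cases hφ : φ ∈ E
    · obtain ⟨bad, h⟩ := hn φ (hE hφ)
      exact ⟨bad, fun _ => h⟩
    · exact ⟨∅, fun h => absurd h hφ⟩
  choose bad hbad using hbad
  have hprofile : ∀ φ ∈ E, ∀ v ∉ bad φ, ∀ t ∈ T,
      profile H F (φ (σ n t v) : FullShift G k) = profile H F (t • (φ v : FullShift G k)) :=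
    fun φ hφ v hv t ht =>
      profile_congr fun g hg => (hbad φ hφ).2 v hv t ht g (Finset.mem_insert_of_mem hg)
  let _ : MulAction G (G ⧸ H → Finset (Fin k)) := arrowAction
  have hbound := card_le_of_approximately_equivariant (σ n) P hPne E
    (fun φ v => profile H F (φ v : FullShift G k)) (fun φ v (g : W) => (φ v : FullShift G k) g)
    (fun φ v => (φ v : FullShift G k) 1) (fun c => c ((1 : G) : G ⧸ H)) bad
    (Finset.univ.filter fun v => ¬ Set.InjOn (fun s => σ n s v) P)
    (fun v hv => by simpa using hv)
    (fun φ hφ v hv s hs => by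
      rw [hprofile φ hφ v hv s (by simp [hT, hs])]
      funext w
      exact hF.profile_smul (φ v).2 s w)
    (fun φ _ v => hF.apply_one_mem_profile (φ v).2)
    (fun φ hφ φ' hφ' hψ hq => by
      by_contra hne
      refine (hsep φ hφ φ' hφ' hne).not_ge (Real.iSup_le (fun v => (hW _ _ fun g hg => ?_).le) hε.le)
      by_cases hv : v ∈ bad φ ∨ v ∈ bad φ'
      · exact congrFun (hq v hv) ⟨g, hg⟩
      · rw [not_or] at hv
        have hgT : g⁻¹ ∈ T := by
          simp only [hT, Finset.mem_union]
          exact Or.inl (Or.inr (Finset.mem_image_of_mem _ hg))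
        have h1 := (hbad φ hφ).2 v hv.1 g⁻¹ hgT 1 (Finset.mem_insert_self _ _)
        have h2 := (hbad φ' hφ').2 v hv.2 g⁻¹ hgT 1 (Finset.mem_insert_self _ _)
        rw [FullShift.smul_apply, inv_inv, mul_one] at h1 h2
        rw [← h1, ← h2]
        exact congrFun hψ _)
    (β := β) (N := Real.exp (η / 2 * Fintype.card (V n)))
    (K := Real.exp (Fintype.card (V n) * (cosetEntropy H x + η / 2)))
    (hsparse (V n)) (Real.exp_pos _).le
    (fun φ hφ => by
      refine (hF.prod_card_profile_le (σ n) φ (bad φ) fun v hv w =>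
        hprofile φ hφ v hv _ (by simp [hT])).trans (Real.exp_le_exp.2 ?_)
      have h1 : ((bad φ).card : ℝ) ≤ β₁ * Fintype.card (V n) := (hbad φ hφ).1
      have h2 : β₁ * (Real.log k + 1) ≤ η / 2 := by
        have := mul_le_mul_of_nonneg_right (min_le_right (β / 3) (η / (2 * (Real.log k + 1))))
          (show 0 ≤ Real.log k + 1 by positivity)
        refine this.trans_eq ?_
        field_simp
      have h3 := mul_le_mul_of_nonneg_right h1 hlog
      have h4 := mul_le_mul_of_nonneg_right h2 (Nat.cast_nonneg (α := ℝ) (Fintype.card (V n)))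
      have h5 : 0 ≤ β₁ * Fintype.card (V n) := by positivity
      nlinarith)
    hβ.le hPβ hfree
    (fun φ hφ => (hbad φ hφ).1.trans
      (mul_le_mul_of_nonneg_right (min_le_left _ _) (Nat.cast_nonneg _)))
  refine hbound.trans_eq ?_
  rw [← Real.exp_add, hη]
  congr 1
  ring

/-- If `X` is a point, then there are no two separated maps. -/
theorem soficEntropyOfPseudometric_le_zero {X : Type*} [SMul G X] [Subsingleton X]
    (hσ : IsSoficApproximation V σ) (d : X → X → ℝ) :
    soficEntropyOfPseudometric V σ d ≤ 0 := by
  refine iSup₂_le fun ε _ => iInf_le_of_le ∅ (iInf₂_le_of_le 1 one_pos ?_)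
  refine limsup_le_of_le (by isBoundedDefault) ?_
  filter_upwards [hσ.eventually_card_pos] with n hpos
  rw [← EReal.coe_zero]
  refine log_sepNumber_div_le hpos fun E _ _ => ?_
  rw [mul_zero, Real.exp_zero]
  exact_mod_cast Finset.card_le_one_of_subsingleton E

end Bound

/-! ### Densities of holes -/

section Holes

variable {G A : Type*} [Group G] {H K : Subgroup G}

theorem skeleton_eq_none_iff {x : G → A} {g : G} :
    skeleton H x g = none ↔ g ∉ perPart H x := by
  classical
  simp [skeleton]

theorem inv_mul_mem_perPart_iff {x : G → A} {h g : G} (hh : h ∈ H) :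
    h⁻¹ * g ∈ perPart H x ↔ g ∈ perPart H x := by
  have key : ∀ {h g : G}, h ∈ H → g ∈ perPart H x → h⁻¹ * g ∈ perPart H x := by
    intro h g hh hg u hu
    rw [hg h hh, ← mul_assoc, ← mul_inv_rev, hg _ (H.mul_mem hh hu)]
  refine ⟨fun h1 => ?_, key hh⟩
  simpa using key (H.inv_mem hh) h1

/-- The holes of `x` are the cosets disjoint from the periodic part. -/
theorem numHoles_eq (H : Subgroup G) (x : G → A) :
    numHoles H x = {v : G ⧸ H | ∀ g : G, (g : G ⧸ H) = v → g ∉ perPart H x}.ncard := by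
  refine congrArg Set.ncard (Set.ext fun v => forall_congr' fun g => forall_congr' fun _ => ?_)
  refine ⟨fun h => skeleton_eq_none_iff.1 h.2, fun h => ⟨fun u hu => ?_, skeleton_eq_none_iff.2 h⟩⟩
  rw [skeleton_eq_none_iff.2 h, skeleton_eq_none_iff, inv_mul_mem_perPart_iff hu]
  exact h

theorem numHoles_div_index_nonneg (H : Subgroup G) (x : G → A) :
    0 ≤ (numHoles H x : ℝ) / H.index := by positivity

/-- Every hole for a smaller subgroup lies in a hole for the larger one. -/
theorem numHoles_div_index_antitone [H.Normal] [K.FiniteIndex] (h : K ≤ H) (x : G → A) :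
    (numHoles K x : ℝ) / K.index ≤ (numHoles H x : ℝ) / H.index := by
  classical
  have hfin : H.FiniteIndex := Subgroup.finiteIndex_of_le h
  have hK : (0 : ℝ) < K.index := by
    exact_mod_cast Nat.pos_of_ne_zero (Subgroup.FiniteIndex.index_ne_zero)
  have hH : (0 : ℝ) < H.index := by
    exact_mod_cast Nat.pos_of_ne_zero (Subgroup.FiniteIndex.index_ne_zero)
  have hmem : ∀ v ∈ {v : G ⧸ K | ∀ g : G, (g : G ⧸ K) = v → g ∉ perPart K x},
      (Subgroup.quotientEquivProdOfLE h v).1 ∈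
        {v : G ⧸ H | ∀ g : G, (g : G ⧸ H) = v → g ∉ perPart H x} := by
    intro v
    induction v using QuotientGroup.induction_on with | H g₀ => ?_
    intro hv g hg hgper
    have h1 : g * g₀⁻¹ ∈ H := by
      have : g₀⁻¹ * g ∈ H := QuotientGroup.eq.1 hg.symm
      have := (inferInstance : H.Normal).conj_mem _ this g
      simpa [mul_assoc] using this
    refine hv g₀ rfl (perPart_mono h _ ?_)
    simpa [mul_assoc] using (inv_mul_mem_perPart_iff h1).2 hgper
  have hcard : numHoles K x ≤ numHoles H x * K.relIndex H := by
    have hrel : K.relIndex H = (Set.univ : Set (H ⧸ K.subgroupOf H)).ncard := by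
      rw [Set.ncard_univ]; rfl
    rw [numHoles_eq, numHoles_eq, hrel, ← Set.ncard_prod]
    exact Set.ncard_le_ncard_of_injOn (Subgroup.quotientEquivProdOfLE h)
      (fun v hv => ⟨hmem v hv, trivial⟩) (Equiv.injective _).injOn (Set.toFinite _)
  have hidx : (K.index : ℝ) = K.relIndex H * H.index := by
    exact_mod_cast (Subgroup.relIndex_mul_index h).symm
  rw [div_le_div_iff₀ hK hH, hidx, ← mul_assoc]
  exact mul_le_mul_of_nonneg_right (by exact_mod_cast hcard) hH.le

theorem cosetEntropy_le [H.Normal] [H.FiniteIndex] {k : ℕ} (x : G → Fin k) :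
    cosetEntropy H x ≤ (numHoles H x : ℝ) / H.index * Real.log k := by
  classical
  have : Fintype (G ⧸ H) := Fintype.ofFinite _
  rw [cosetEntropy, finsum_eq_sum_of_fintype, numHoles_eq]
  set Z : Set (G ⧸ H) := {v | ∀ g : G, (g : G ⧸ H) = v → g ∉ perPart H x} with hZ
  have hterm : ∀ v : G ⧸ H, Real.log (cosetSymbols H x v) ≤ if v ∈ Z then Real.log k else 0 := by
    intro v
    split_ifs with hv
    · have h1 : cosetSymbols H x v ≤ k := by
        refine (Set.ncard_le_card _).trans_eq ?_
        simp
      rcases Nat.eq_zero_or_pos (cosetSymbols H x v) with h0 | h0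
      · rw [h0]; simp [Real.log_natCast_nonneg]
      · exact Real.log_le_log (by exact_mod_cast h0) (by exact_mod_cast h1)
    · simp only [hZ, Set.mem_ofPred_eq, not_forall, not_not] at hv
      obtain ⟨g, rfl, hg⟩ := hv
      have h1 : x '' {u : G | (u : G ⧸ H) = g} = {x g} := by
        ext a
        constructor
        · rintro ⟨u, hu, rfl⟩
          have h2 : g * u⁻¹ ∈ H := by
            have := QuotientGroup.eq.1 hu.symm
            have := (inferInstance : H.Normal).conj_mem _ (H.inv_mem this) g
            simpa [mul_assoc] using this
          have := hg _ h2
          simpa [mul_assoc] using this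
        · rintro rfl
          exact ⟨g, rfl, rfl⟩
      rw [cosetSymbols, h1, Set.ncard_singleton]
      simp
  have hsum := Finset.sum_le_sum fun v (_ : v ∈ Finset.univ) => hterm v
  rw [← Finset.sum_filter, Finset.sum_const, nsmul_eq_mul] at hsum
  have hcard : Z.ncard = (Finset.univ.filter fun v => v ∈ Z).card := by
    rw [← Set.ncard_coe_finset]; simp
  rw [hcard, one_div, inv_mul_eq_div, div_mul_eq_mul_div]
  exact div_le_div_of_nonneg_right hsum (Nat.cast_nonneg _)

end Holes

/-! ### Comparison with the lower limit of the coset entropies -/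

theorem soficEntropy_le_liminf_of_infinite {G : Type*} [Group G] [Infinite G] {k : ℕ}
    {H : ℕ → Subgroup G} [∀ n, (H n).Normal] [∀ n, (H n).FiniteIndex]
    (hanti : Antitone H) {x : FullShift G k} (hx : IsToeplitz H x)
    {V : ℕ → Type*} [∀ n, Fintype (V n)] {σ : ∀ n, G → Equiv.Perm (V n)}
    (hσ : IsSoficApproximation V σ) :
    soficEntropy G (orbitClosure (G := G) x) V σ
      ≤ liminf (fun n => ((cosetEntropy (H n) x : ℝ) : EReal)) atTop := by
  refine le_liminf_of_le (by isBoundedDefault) (Eventually.of_forall fun m => ?_)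
  obtain ⟨F, hF⟩ := exists_isCompleteWindow H hanti hx m
  exact iSup_le fun d => iSup₂_le fun hd hgen => hF.soficEntropyOfPseudometric_le hσ hd hgen

theorem soficEntropy_le_liminf_of_subsingleton {G : Type*} [Group G] [Subsingleton G] {k : ℕ}
    (H : ℕ → Subgroup G) (x : FullShift G k)
    {V : ℕ → Type*} [∀ n, Fintype (V n)] {σ : ∀ n, G → Equiv.Perm (V n)}
    (hσ : IsSoficApproximation V σ) :
    soficEntropy G (orbitClosure (G := G) x) V σ
      ≤ liminf (fun n => ((cosetEntropy (H n) x : ℝ) : EReal)) atTop := by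
  have hX : Subsingleton (orbitClosure (G := G) x) := by
    have h : ∀ y ∈ orbitClosure (G := G) x, y = x := by
      intro y hy
      obtain ⟨g, hg⟩ := exists_smul_eqOn hy {1}
      funext u
      rw [Subsingleton.elim u 1, ← hg 1 (Finset.mem_singleton_self 1), Subsingleton.elim g 1,
        one_smul]
    exact ⟨fun y z => Subtype.ext ((h y y.2).trans (h z z.2).symm)⟩
  refine le_liminf_of_le (by isBoundedDefault) (Eventually.of_forall fun m => ?_)
  exact iSup_le fun d => iSup₂_le fun _ _ =>
    (soficEntropyOfPseudometric_le_zero hσ d).trans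
      (by exact_mod_cast cosetEntropy_nonneg (H m) x)

theorem mainTheorem3 {G : Type*} [Group G] [Countable G] (k : ℕ)
    (H : ℕ → Subgroup G) [∀ n, (H n).Normal] [∀ n, (H n).FiniteIndex]
    (hanti : Antitone H) (hbot : ⨅ n, H n = ⊥)
    (x : FullShift G k) (hx : IsToeplitz H x) :
    -- the right-hand limit exists and bounds the lower limit
    (∃ L : ℝ,
      Tendsto (fun n => (numHoles (H n) x : ℝ) / ((H n).index : ℝ)) atTop (𝓝 L) ∧
      liminf (fun n => ((cosetEntropy (H n) x : ℝ) : EReal)) atTop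
        ≤ ((L * Real.log k : ℝ) : EReal)) ∧
    -- sofic approximations by homomorphisms
    (Infinite G →
      ∀ (V : ℕ → Type*) [∀ n, Fintype (V n)] (σ : ∀ n, G →* Equiv.Perm (V n)),
        IsSoficApproximation V (fun n g => σ n g) →
        (∀ n, (σ n).ker ≤ H n) →
        soficEntropy G (orbitClosure (G := G) x) V (fun n g => σ n g)
          ≤ liminf (fun n => ((cosetEntropy (H n) x : ℝ) : EReal)) atTop) ∧
    -- arbitrary sofic approximations of finitely generated free groups
    (∀ (S : Type*) [Finite S] (b : FreeGroupBasis S G)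
      (V : ℕ → Type*) [∀ n, Fintype (V n)] (σ : ∀ n, G → Equiv.Perm (V n)),
        IsSoficApproximation V σ →
        (∀ n, freeStab b (σ n) ⊆ (H n : Set G)) →
        soficEntropy G (orbitClosure (G := G) x) V σ
          ≤ liminf (fun n => ((cosetEntropy (H n) x : ℝ) : EReal)) atTop) := by
  refine ⟨?_, fun _ V _ σ hσ _ => soficEntropy_le_liminf_of_infinite hanti hx hσ, ?_⟩
  · have hmono : Antitone fun n => (numHoles (H n) x : ℝ) / (H n).index := fun m n hmn =>
      numHoles_div_index_antitone (hanti hmn) x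
    have hbdd : BddBelow (Set.range fun n => (numHoles (H n) x : ℝ) / (H n).index) :=
      ⟨0, by rintro _ ⟨n, rfl⟩; exact numHoles_div_index_nonneg (H n) x⟩
    have hlim := tendsto_atTop_ciInf hmono hbdd
    refine ⟨_, hlim, ?_⟩
    have hE := (continuous_coe_real_ereal.tendsto _).comp (hlim.mul_const (Real.log k))
    rw [← hE.liminf_eq]
    exact liminf_le_liminf (Eventually.of_forall fun n =>
      EReal.coe_le_coe_iff.2 (cosetEntropy_le (H := H n) x))
  · intro S _ b V _ σ hσ _
    cases isEmpty_or_nonempty S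
    · have : Subsingleton G := b.repr.toEquiv.subsingleton
      exact soficEntropy_le_liminf_of_subsingleton H x hσ
    · have : Infinite G := b.repr.toEquiv.infinite_iff.2 inferInstance
      exact soficEntropy_le_liminf_of_infinite hanti hx hσ
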